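/- Let $n\ge 1$ and let $\mathcal G$ be a weighted digraph on the followers $\{1,\dots,n\}$ with adjacency matrix $A=[a_{ij}]$, where $a_{ij}\ge 0$, $a_{ii}=0$, and $(i,j)$ is an arc if and only if $a_{ij}>0$. Let $b_1,\dots,b_n\ge 0$, and let $\bar{\mathcal G}$ be the digraph obtained from $\mathcal G$ by adding a node $0$ (the leader) and an arc $(i,0)$ for every $i$ with $b_i>0$. Node $0$ is called globally reachable in $\bar{\mathcal G}$ if there is a directed path in $\bar{\mathcal G}$ from every $i\in\{1,\dots,n\}$ to $0$. Put $L=\operatorname{diag}\big(\sum_j a_{1j},\dots,\sum_j a_{nj}\big)-A$, $B=\operatorname{diag}(b_1,\dots,b_n)$ and $H=L+B$. For second-order agents following a leader of constant velocity with coupling gain $k>0$ and time-varying coupling delay $r(t)$, the vector $\epsilon(t)=(\bar x(t),\bar v(t))\in\mathbb R^{2n}$ of position and velocity errors satisfies $$\dot\epsilon(t)=C\epsilon(t)+E\epsilon(t-r(t))\quad(t>0),\qquad C=\begin{pmatrix}0&I_n\\0&-kI_n\end{pmatrix},\quad E=\begin{pmatrix}0&0\\-H&0\end{pmatrix},\tag{1}$$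 with a continuous initial function on $[-\tau,0]$, where $r$ is continuously differentiable on $[0,\infty)$ and $0<r(t)<\tau$ for all $t\ge 0$. If node $0$ is globally reachable in $\bar{\mathcal G}$, then there is a unique symmetric positive definite matrix $\bar P$ with $\bar PH+H^T\bar P=I_n$. Whenever such a $\bar P$ exists, let $\bar\mu$ be the largest eigenvalue of $\bar PHH^T\bar P$, let $\bar\lambda$ be the smallest eigenvalue of $\bar P$, and let $k^*=\frac{\bar\mu}{2\bar\lambda}+1$. Let $k>0$, and suppose that $k>k^*$ whenever $\bar P$ exists. Then there is $\tau_0>0$ such that for every $\tau\in(0,\tau_0]$ and every delay $r$ as above the following holds: every solution of (1) satisfies $\lim_{t\to\infty}\epsilon(t)=0$ if and only if node $0$ is globally reachable in $\bar{\mathcal G}$. Moreover, if $\bar P$ exists, then for every $q>1$ the number $$\tau_0=\frac{\lambda_{\min}(Q)}{\|PECP^{-1}C^TE^TP\|+q\|P\|},\qquad P=\begin{pmatrix}k\bar P&\bar P\\\bar P&\bar P\end{pmatrix},\quad Q=\begin{pmatrix}I_n&H^T\bar P\\\bar PH&2(k-1)\bar P\end{pmatrix},$$ is positive and has this property; here $\lambda_{\min}(Q)$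 is the smallest eigenvalue of $Q$ and $\|\cdot\|$ is the matrix norm induced by the Euclidean norm. -/

import Mathlib

open Filter Topology Set
open scoped Matrix

noncomputable section

namespace LeaderFollowing

/-- A weighted digraph on the followers `Fin n` (adjacency matrix `A`, with `A i j > 0` exactly
when `(i, j)` is an arc) together with the weights `b i` of the arcs from the followers to the
leader (`b i > 0` exactly when the leader is a neighbour of `i`). -/
structure Network (n : ℕ) where
  /-- weighted adjacency matrix of the follower graph -/
  A : Matrix (Fin n) (Fin n) ℝ
  /-- diagonal of the leader adjacency matrix -/
  b : Fin n → ℝ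
  A_nonneg : ∀ i j, 0 ≤ A i j
  A_diag : ∀ i, A i i = 0
  b_nonneg : ∀ i, 0 ≤ b i

variable {n : ℕ}

/-- The augmented digraph: `none` is the leader (node `0`), `some i` is the follower `i`. The
leader is not influenced by the followers, so no arc starts at it. -/
def Network.augmentedGraph (N : Network n) : Digraph (Option (Fin n)) where
  Adj
    | some i, some j => 0 < N.A i j
    | some i, none => 0 < N.b i
    | none, _ => False

/-- There is a path from `u` to `w`: distinct nodes `p 0 = u, p 1, …, p f = w`, `f ≥ 1`, with an
arc from each one to the next one. -/
def HasPath {V : Type*} (G : Digraph V) (u w : V) : Prop :=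
  ∃ f : ℕ, 1 ≤ f ∧ ∃ p : Fin (f + 1) → V, Function.Injective p ∧
    p 0 = u ∧ p (Fin.last f) = w ∧ ∀ s : Fin f, G.Adj (p s.castSucc) (p s.succ)

/-- The leader is globally reachable: every follower has a path to it. -/
def Network.LeaderGloballyReachable (N : Network n) : Prop :=
  ∀ i : Fin n, HasPath N.augmentedGraph (some i) none

/-- The Laplacian `L = D - A`, with `D` the diagonal matrix of the row sums of `A`. -/
def Network.laplacian (N : Network n) : Matrix (Fin n) (Fin n) ℝ :=
  Matrix.diagonal (fun i => ∑ j, N.A i j) - N.A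

/-- `H = L + B`. -/
def Network.H (N : Network n) : Matrix (Fin n) (Fin n) ℝ :=
  N.laplacian + Matrix.diagonal N.b

/-- `C = [[0, I], [0, -k I]]`. -/
def matC (n : ℕ) (k : ℝ) : Matrix (Fin n ⊕ Fin n) (Fin n ⊕ Fin n) ℝ :=
  Matrix.fromBlocks 0 1 0 (-(k • (1 : Matrix (Fin n) (Fin n) ℝ)))

/-- `E = [[0, 0], [-H, 0]]`. -/
def matE (H : Matrix (Fin n) (Fin n) ℝ) : Matrix (Fin n ⊕ Fin n) (Fin n ⊕ Fin n) ℝ :=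
  Matrix.fromBlocks 0 0 (-H) 0

/-- A continuously differentiable time-varying delay on `[0, ∞)` with `0 < r < τ`. -/
def IsDelay (τ : ℝ) (r : ℝ → ℝ) : Prop :=
  ContDiffOn ℝ 1 r (Ici 0) ∧ ∀ t, 0 ≤ t → 0 < r t ∧ r t < τ

/-- `ε`, restricted to `[-τ, ∞)`, is a solution of `ε'(t) = C ε(t) + E ε(t - r(t))`, `t > 0`, with
some continuous initial function on `[-τ, 0]`. The components of `ε` are the position errors
(index `Sum.inl i`) and the velocity errors (index `Sum.inr i`). -/
def IsErrorSolution (N : Network n) (k τ : ℝ) (r : ℝ → ℝ) (ε : ℝ → (Fin n ⊕ Fin n → ℝ)) : Prop :=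
  ContinuousOn ε (Ici (-τ)) ∧
    ∀ t, 0 < t → HasDerivAt ε (matC n k *ᵥ ε t + matE N.H *ᵥ ε (t - r t)) t

/-- Every solution of the delayed error system tends to `0`, whatever its initial function. -/
def ErrorsVanish (N : Network n) (k τ : ℝ) (r : ℝ → ℝ) : Prop :=
  ∀ ε, IsErrorSolution N k τ r ε → Tendsto ε atTop (𝓝 0)

/-- `P` is a (symmetric) positive definite solution of the Lyapunov equation
`P H + Hᵀ P = I`. -/
def IsLyapunovSolution (H P : Matrix (Fin n) (Fin n) ℝ) : Prop :=
  P.PosDef ∧ P * H + Hᵀ * P = 1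

/-- The largest real eigenvalue. It is applied to nonempty symmetric matrices only, whose
spectrum is finite and nonempty. -/
def maxEigenvalue {ι : Type*} [Fintype ι] [DecidableEq ι] (M : Matrix ι ι ℝ) : ℝ :=
  sSup (spectrum ℝ M)

/-- The smallest real eigenvalue. It is applied to nonempty symmetric matrices only. -/
def minEigenvalue {ι : Type*} [Fintype ι] [DecidableEq ι] (M : Matrix ι ι ℝ) : ℝ :=
  sInf (spectrum ℝ M)

/-- `k* = μ / (2 λ) + 1`, where `μ` is the largest eigenvalue of `P H Hᵀ P` and `λ` is the
smallest eigenvalue of `P`. -/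
def kStar (H P : Matrix (Fin n) (Fin n) ℝ) : ℝ :=
  maxEigenvalue (P * H * Hᵀ * P) / (2 * minEigenvalue P) + 1

/-- The matrix norm induced by the Euclidean norm. -/
def matNorm {ι : Type*} [Fintype ι] [DecidableEq ι] (M : Matrix ι ι ℝ) : ℝ :=
  ‖Matrix.toEuclideanCLM (𝕜 := ℝ) M‖

/-- `[[k P, P], [P, P]]`. -/
def bigP (k : ℝ) (P : Matrix (Fin n) (Fin n) ℝ) : Matrix (Fin n ⊕ Fin n) (Fin n ⊕ Fin n) ℝ :=
  Matrix.fromBlocks (k • P) P P P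

/-- `Q = [[I, Hᵀ P], [P H, 2 (k - 1) P]]`. -/
def bigQ (k : ℝ) (H P : Matrix (Fin n) (Fin n) ℝ) :
    Matrix (Fin n ⊕ Fin n) (Fin n ⊕ Fin n) ℝ :=
  Matrix.fromBlocks 1 (Hᵀ * P) (P * H) ((2 * (k - 1)) • P)

/-- The explicit delay bound
`λ_min(Q) / (‖𝐏 E C 𝐏⁻¹ Cᵀ Eᵀ 𝐏‖ + q ‖𝐏‖)`, where `𝐏 = [[k P, P], [P, P]]`. -/
def delayBound (k q : ℝ) (H P : Matrix (Fin n) (Fin n) ℝ) : ℝ :=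
  minEigenvalue (bigQ k H P) /
    (matNorm (bigP k P * matE H * matC n k * (bigP k P)⁻¹ * (matC n k)ᵀ * (matE H)ᵀ * bigP k P)
      + q * matNorm (bigP k P))

end LeaderFollowing

end

/-!
The proof is elementary throughout.

*Graph theory.* If some follower has no path to the leader, the rows of `H` belonging to the
followers without a path form a singular diagonal block, so `H x = 0` for some `x ≠ 0`
(`exists_H_mulVec_eq_zero`), and `(x, 0)` is an equilibrium of the error system for every delay. If
the leader is globally reachable, a minimum principle holds for `H` (`nonneg_of_H_mulVec_nonneg`),
so `H` is invertible with nonnegative inverse, and the positive vector `v` with `vᵀ H = (1, …, 1)`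
gives a diagonal matrix `D` with `D H + Hᵀ D` positive definite (`posDef_diagonal_mul_H`).

*Lyapunov equation.* For a symmetric `X` the problem `X x = λ D x` has a basis of solutions, and on
such an `x` the form of `X H + Hᵀ X` is `λ` times the positive form of `D H + Hᵀ D`. So
`X ↦ X H + Hᵀ X` is injective, hence surjective, on symmetric matrices, and the solution of
`X H + Hᵀ X = I` has only positive `λ`. This gives existence and uniqueness of the Lyapunov matrix
without any matrix exponentials.

*Delay.* With `𝐏 = bigP k P` one has `𝐏 (C + E) + (C + E)ᵀ 𝐏 = -Q`, and `k > k*` makes `𝐏` and `Q`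
positive definite. As `E * E = 0`, the term `E ε(t - r) - E ε(t)` is controlled by the mean value
inequality through `E C ε` alone (`delay_term_le`), and Razumikhin's principle (`razumikhin`)
applied to `V = εᵀ 𝐏 ε` yields `ε → 0` (`tendsto_zero_of_small_delay`). The slack `q > 1` in the
bound on the delay provides a uniform decay rate even when `r t` comes arbitrarily close to that bound.
-/

namespace LeaderFollowing

/-! ### Extreme eigenvalues, quadratic forms and the operator norm -/

section Spectral

variable {ι : Type*} [Fintype ι]

theorem dotProduct_self_nonneg (x : ι → ℝ) : 0 ≤ x ⬝ᵥ x := by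
  simpa using dotProduct_star_self_nonneg x

theorem dotProduct_mulVec_comm_of_isHermitian {M : Matrix ι ι ℝ} (hM : M.IsHermitian)
    (x y : ι → ℝ) : x ⬝ᵥ M *ᵥ y = y ⬝ᵥ M *ᵥ x := by
  have hT : Mᵀ = M := by simpa [Matrix.IsHermitian] using hM
  rw [Matrix.dotProduct_mulVec, ← Matrix.mulVec_transpose, hT, dotProduct_comm]

variable [DecidableEq ι] {M : Matrix ι ι ℝ}

theorem le_quadratic_of_le_spectrum (hM : M.IsHermitian) {c : ℝ}
    (h : ∀ z ∈ spectrum ℝ M, c ≤ z) (x : ι → ℝ) : c * (x ⬝ᵥ x) ≤ x ⬝ᵥ M *ᵥ x := by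
  have hps : (M - algebraMap ℝ (Matrix ι ι ℝ) c).PosSemidef := by
    refine Matrix.posSemidef_iff_isHermitian_and_spectrum_nonneg.2 ⟨hM.sub ?_, ?_⟩
    · rw [Algebra.algebraMap_eq_smul_one]
      simp [Matrix.IsHermitian]
    · rw [← spectrum.sub_singleton_eq]
      rintro _ ⟨z, hz, w, hw, rfl⟩
      obtain rfl : w = c := hw
      exact sub_nonneg.2 (h z hz)
  have := hps.dotProduct_mulVec_nonneg x
  rw [Algebra.algebraMap_eq_smul_one, Matrix.sub_mulVec, Matrix.smul_mulVec, Matrix.one_mulVec,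
    dotProduct_sub, dotProduct_smul] at this
  simpa using this

theorem finite_spectrum (hM : M.IsHermitian) : (spectrum ℝ M).Finite := by
  rw [hM.spectrum_real_eq_range_eigenvalues]
  exact Set.finite_range _

theorem minEigenvalue_mul_le (hM : M.IsHermitian) (x : ι → ℝ) :
    minEigenvalue M * (x ⬝ᵥ x) ≤ x ⬝ᵥ M *ᵥ x :=
  le_quadratic_of_le_spectrum hM (fun _ hz => csInf_le (finite_spectrum hM).bddBelow hz) x

theorem le_maxEigenvalue_mul (hM : M.IsHermitian) (x : ι → ℝ) :
    x ⬝ᵥ M *ᵥ x ≤ maxEigenvalue M * (x ⬝ᵥ x) := by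
  have := le_quadratic_of_le_spectrum hM.neg (c := -maxEigenvalue M) (fun z hz => by
    rw [← spectrum.neg_eq] at hz
    have := le_csSup (finite_spectrum hM).bddAbove hz
    exact neg_le.1 this) x
  simp only [Matrix.neg_mulVec, dotProduct_neg] at this
  linarith

theorem minEigenvalue_pos [Nonempty ι] (hM : M.PosDef) : 0 < minEigenvalue M := by
  have hS := hM.isHermitian.spectrum_real_eq_range_eigenvalues
  have hne : (spectrum ℝ M).Nonempty := hS ▸ Set.range_nonempty _
  have hmem : minEigenvalue M ∈ spectrum ℝ M := hne.csInf_mem (finite_spectrum hM.isHermitian)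
  rw [hS] at hmem
  obtain ⟨i, hi⟩ := hmem
  exact hi ▸ hM.eigenvalues_pos i

theorem quadratic_le_matNorm (M : Matrix ι ι ℝ) (x : ι → ℝ) :
    x ⬝ᵥ M *ᵥ x ≤ matNorm M * (x ⬝ᵥ x) := by
  have h1 := Matrix.inner_toEuclideanCLM M (WithLp.toLp 2 x) (WithLp.toLp 2 x)
  have h2 := real_inner_le_norm (WithLp.toLp 2 x)
    (Matrix.toEuclideanCLM (𝕜 := ℝ) M (WithLp.toLp 2 x))
  have h3 := (Matrix.toEuclideanCLM (𝕜 := ℝ) M).le_opNorm (WithLp.toLp 2 x)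
  have h4 : x ⬝ᵥ x = ‖WithLp.toLp 2 x‖ * ‖WithLp.toLp 2 x‖ := by
    rw [← sq, EuclideanSpace.real_norm_sq_eq]
    simp [dotProduct, sq]
  rw [h1] at h2
  refine h2.trans ?_
  rw [h4, matNorm]
  calc _ ≤ ‖WithLp.toLp 2 x‖ * (‖Matrix.toEuclideanCLM (𝕜 := ℝ) M‖ * ‖WithLp.toLp 2 x‖) := by
        gcongr
    _ = _ := by ring

theorem matNorm_nonneg (M : Matrix ι ι ℝ) : 0 ≤ matNorm M := norm_nonneg _

theorem matNorm_pos [Nonempty ι] (hM : M.PosDef) : 0 < matNorm M := by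
  refine norm_pos_iff.2 fun h => ?_
  have hM0 : M = 0 := by simpa using h
  obtain ⟨i⟩ := ‹Nonempty ι›
  have := hM.diag_pos (i := i)
  simp [hM0] at this

end Spectral

/-! ### The Lyapunov equation -/

section Lyapunov

variable {ι : Type*} [Fintype ι] {H : Matrix ι ι ℝ}

/-- On a vector with `X x = λ D x` the quadratic form of `X H + Hᵀ X` is `λ` times that of
`D H + Hᵀ D`. -/
theorem quadratic_lyapunov_of_eigen {X D : Matrix ι ι ℝ} (hX : X.IsHermitian)
    (hD : D.IsHermitian) {x : ι → ℝ} {l : ℝ} (hx : X *ᵥ x = l • (D *ᵥ x)) :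
    x ⬝ᵥ (X * H + Hᵀ * X) *ᵥ x = l * (x ⬝ᵥ (D * H + Hᵀ * D) *ᵥ x) := by
  have key : ∀ Z : Matrix ι ι ℝ, Z.IsHermitian →
      x ⬝ᵥ (Z * H + Hᵀ * Z) *ᵥ x = 2 * ((Z *ᵥ x) ⬝ᵥ H *ᵥ x) := by
    intro Z hZ
    rw [Matrix.add_mulVec, dotProduct_add, ← Matrix.mulVec_mulVec, ← Matrix.mulVec_mulVec,
      dotProduct_mulVec_comm_of_isHermitian hZ x (H *ᵥ x), dotProduct_comm (H *ᵥ x),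
      Matrix.dotProduct_mulVec x Hᵀ, Matrix.vecMul_transpose, dotProduct_comm (H *ᵥ x)]
    ring
  rw [key X hX, key D hD, hx, smul_dotProduct, smul_eq_mul]
  ring

variable [DecidableEq ι]

/-- A symmetric matrix `X` is diagonalisable relative to a positive diagonal matrix: the
generalised eigenvalue problem `X x = λ D x` reduces to the symmetric matrix
`D^(-1/2) X D^(-1/2)`. Here `S = D^(-1/2)`. -/
theorem exists_generalized_eigenvector {d : ι → ℝ} (hd : ∀ i, 0 < d i) {X : Matrix ι ι ℝ}
    (hX : X.IsHermitian) :
    ∃ (S : Matrix ι ι ℝ) (hY : (Sᴴ * X * S).IsHermitian), IsUnit S ∧ ∀ i, ∃ x : ι → ℝ, x ≠ 0 ∧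
      X *ᵥ x = hY.eigenvalues i • (Matrix.diagonal d *ᵥ x) := by
  have hs : ∀ i, Real.sqrt (d i) ≠ 0 := fun i => (Real.sqrt_pos.2 (hd i)).ne'
  set S : Matrix ι ι ℝ := Matrix.diagonal fun i => (Real.sqrt (d i))⁻¹ with hS
  set T : Matrix ι ι ℝ := Matrix.diagonal fun i => Real.sqrt (d i) with hT
  have hTS : T * S = 1 := by
    rw [hT, hS, Matrix.diagonal_mul_diagonal, ← Matrix.diagonal_one]
    congr 1; ext i; exact mul_inv_cancel₀ (hs i)
  have hST : S * T = 1 := mul_eq_one_comm.1 hTS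
  have hTT : T = Matrix.diagonal d * S := by
    rw [hT, hS, Matrix.diagonal_mul_diagonal]
    congr 1; ext i
    rw [eq_mul_inv_iff_mul_eq₀ (hs i), Real.mul_self_sqrt (hd i).le]
  have hSH : Sᴴ = S := by simp [hS]
  have hY : (Sᴴ * X * S).IsHermitian := Matrix.isHermitian_conjTranspose_mul_mul S hX
  refine ⟨S, hY, IsUnit.of_mul_eq_one T hST, fun i => ?_⟩
  have hy := hY.mulVec_eigenvectorBasis i
  set y : ι → ℝ := (hY.eigenvectorBasis i).ofLp with hydef
  have hy0 : y ≠ 0 := by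
    intro h
    apply (hY.eigenvectorBasis.orthonormal.ne_zero i)
    ext j
    exact congrFun h j
  refine ⟨S *ᵥ y, fun h => hy0 ?_, ?_⟩
  · have := congrArg (T *ᵥ ·) h
    simpa [Matrix.mulVec_mulVec, hTS] using this
  · have := congrArg (T *ᵥ ·) hy
    simp only [Matrix.mulVec_mulVec, Matrix.mulVec_smul] at this
    have hTX : T * (Sᴴ * X * S) = X * S := by
      rw [hSH, ← Matrix.mul_assoc, ← Matrix.mul_assoc, hTS, Matrix.one_mul]
    rw [hTX] at this
    rw [Matrix.mulVec_mulVec, this, Matrix.mulVec_mulVec, ← hTT]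

variable {d : ι → ℝ}

theorem eq_zero_of_lyapunov_eq_zero (hd : ∀ i, 0 < d i)
    (hR : (Matrix.diagonal d * H + Hᵀ * Matrix.diagonal d).PosDef) {X : Matrix ι ι ℝ}
    (hX : X.IsHermitian) (h : X * H + Hᵀ * X = 0) : X = 0 := by
  obtain ⟨S, hY, hS, hev⟩ := exists_generalized_eigenvector hd hX
  have h0 : hY.eigenvalues = 0 := by
    ext i
    obtain ⟨x, hx0, hx⟩ := hev i
    have hq := quadratic_lyapunov_of_eigen (H := H) hX (Matrix.isHermitian_diagonal d) hx
    have hpos := hR.dotProduct_mulVec_pos hx0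
    simp only [star_trivial] at hpos
    simp only [h, Matrix.zero_mulVec, dotProduct_zero] at hq
    exact (mul_eq_zero.1 hq.symm).resolve_right hpos.ne'
  have hzero := hY.eigenvalues_eq_zero_iff.1 h0
  have hSH : IsUnit Sᴴ := hS.star
  rwa [hS.mul_left_eq_zero, hSH.mul_right_eq_zero] at hzero

theorem posDef_of_lyapunov_posDef (hd : ∀ i, 0 < d i)
    (hR : (Matrix.diagonal d * H + Hᵀ * Matrix.diagonal d).PosDef) {X : Matrix ι ι ℝ}
    (hX : X.IsHermitian) (h : (X * H + Hᵀ * X).PosDef) : X.PosDef := by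
  obtain ⟨S, hY, hS, hev⟩ := exists_generalized_eigenvector hd hX
  rw [← Matrix.IsUnit.posDef_star_left_conjugate_iff hS]
  change (Sᴴ * X * S).PosDef
  rw [hY.posDef_iff_eigenvalues_pos]
  intro i
  obtain ⟨x, hx0, hx⟩ := hev i
  have hq := quadratic_lyapunov_of_eigen (H := H) hX (Matrix.isHermitian_diagonal d) hx
  have hpos := hR.dotProduct_mulVec_pos hx0
  have hpos' := h.dotProduct_mulVec_pos hx0
  simp only [star_trivial] at hpos hpos'
  rw [hq] at hpos'
  exact pos_of_mul_pos_left hpos' hpos.le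

/-- The Lyapunov operator `X ↦ X H + Hᵀ X` maps the finite-dimensional space of symmetric
matrices to itself; injectivity there gives a solution of the Lyapunov equation. -/
theorem exists_symmetric_lyapunov (hd : ∀ i, 0 < d i)
    (hR : (Matrix.diagonal d * H + Hᵀ * Matrix.diagonal d).PosDef) :
    ∃ X : Matrix ι ι ℝ, X.IsHermitian ∧ X * H + Hᵀ * X = 1 := by
  let V : Submodule ℝ (Matrix ι ι ℝ) :=
    { carrier := {X | X.IsHermitian}
      add_mem' := fun ha hb => ha.add hb
      zero_mem' := Matrix.isHermitian_zero
      smul_mem' := fun c X hX => by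
        have hX' : Xᴴ = X := hX
        change (c • X)ᴴ = c • X
        rw [Matrix.conjTranspose_smul, hX', star_trivial] }
  let Φ : V →ₗ[ℝ] V :=
    { toFun := fun X => ⟨X.1 * H + Hᵀ * X.1, by
        have hX' : X.1ᴴ = X.1 := X.2
        rw [Matrix.conjTranspose_eq_transpose_of_trivial] at hX'
        change (X.1 * H + Hᵀ * X.1)ᴴ = _
        rw [Matrix.conjTranspose_eq_transpose_of_trivial, Matrix.transpose_add,
          Matrix.transpose_mul, Matrix.transpose_mul, Matrix.transpose_transpose, hX', add_comm]⟩
      map_add' := fun X Y => by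
        ext1
        simp only [Submodule.coe_add, Matrix.add_mul, Matrix.mul_add]
        abel
      map_smul' := fun c X => by
        ext1
        simp [smul_add] }
  have hinj : Function.Injective Φ := by
    rw [← LinearMap.ker_eq_bot, LinearMap.ker_eq_bot']
    intro X hX
    ext1
    exact eq_zero_of_lyapunov_eq_zero hd hR X.2 (congrArg Subtype.val hX)
  obtain ⟨X, hX⟩ := LinearMap.injective_iff_surjective.1 hinj ⟨1, Matrix.isHermitian_one⟩
  exact ⟨X.1, X.2, congrArg Subtype.val hX⟩

theorem existsUnique_lyapunovSolution {n : ℕ} {H : Matrix (Fin n) (Fin n) ℝ} {d : Fin n → ℝ}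
    (hd : ∀ i, 0 < d i)
    (hR : (Matrix.diagonal d * H + Hᵀ * Matrix.diagonal d).PosDef) :
    ∃! P : Matrix (Fin n) (Fin n) ℝ, IsLyapunovSolution H P := by
  obtain ⟨X, hX, hX1⟩ := exists_symmetric_lyapunov hd hR
  refine ⟨X, ⟨posDef_of_lyapunov_posDef hd hR hX (hX1 ▸ Matrix.PosDef.one), hX1⟩, ?_⟩
  rintro Y ⟨hY, hY1⟩
  refine sub_eq_zero.1 (eq_zero_of_lyapunov_eq_zero hd hR (hY.isHermitian.sub hX) ?_)
  rw [Matrix.sub_mul, Matrix.mul_sub, ← sub_eq_zero.2 (hY1.trans hX1.symm)]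
  abel

end Lyapunov

/-! ### The scalar Razumikhin principle -/

theorem deriv_nonneg_of_le_left {W : ℝ → ℝ} {w a t : ℝ} (hat : a < t) (hW : HasDerivAt W w t)
    (h : ∀ s, a ≤ s → s < t → W s ≤ W t) : 0 ≤ w := by
  have h1 := (hasDerivWithinAt_iff_tendsto_slope' self_notMem_Iio).1
    (hW.hasDerivWithinAt (s := Iio t))
  refine ge_of_tendsto h1 ?_
  filter_upwards [Ico_mem_nhdsLT hat] with s hs
  rw [slope_def_field]
  exact div_nonneg_of_nonpos (sub_nonpos.2 (h s hs.1 hs.2)) (sub_neg.2 hs.2).le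

/-- Razumikhin's principle: if `V` decays at rate `δ` at every time `t` for which `V ≤ q * V t` on
the preceding window of length `τ`, then `V` tends to `0`. The proof
shows that `W t = exp (γ t) V t` stays below a constant: at a first time where it does not, the
window condition holds and so `W' < 0`. -/
theorem razumikhin {V : ℝ → ℝ} {V' : ℝ → ℝ} {τ q δ : ℝ} (hτ : 0 < τ) (hq : 1 < q) (hδ : 0 < δ)
    (hV0 : ∀ t, 0 ≤ V t) (hV : ∀ t, 0 < t → HasDerivAt V (V' t) t)
    (hdecay : ∀ t, τ < t → (∀ s ∈ Icc (t - τ) t, V s ≤ q * V t) → V' t ≤ -δ * V t) :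
    Tendsto V atTop (𝓝 0) := by
  obtain ⟨γ, hγ0, hγδ, hγq⟩ : ∃ γ : ℝ, 0 < γ ∧ γ < δ ∧ Real.exp (γ * τ) ≤ q := by
    refine ⟨min (δ / 2) (Real.log q / τ), lt_min (by linarith) (div_pos (Real.log_pos hq) hτ),
      (min_le_left _ _).trans_lt (by linarith), ?_⟩
    rw [← Real.le_log_iff_exp_le (by linarith), ← le_div_iff₀ hτ]
    exact min_le_right _ _
  set W : ℝ → ℝ := fun t => Real.exp (γ * t) * V t with hWdef
  have hW : ∀ t, 0 < t → HasDerivAt W (Real.exp (γ * t) * (γ * V t + V' t)) t := by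
    intro t ht
    have h1 : HasDerivAt (fun t => Real.exp (γ * t)) (Real.exp (γ * t) * (γ * 1)) t :=
      ((hasDerivAt_id t).const_mul γ).exp
    exact (h1.mul (hV t ht)).congr_deriv (by ring)
  have hWc : ContinuousOn W (Ioi 0) := fun t ht => (hW t ht).continuousAt.continuousWithinAt
  obtain ⟨K₀, hK₀⟩ : BddAbove (W '' Icc τ (2 * τ)) :=
    (isCompact_Icc.image_of_continuousOn
      (hWc.mono fun t ht => lt_of_lt_of_le hτ ht.1)).bddAbove
  set K := max K₀ 0 + 1 with hK
  have hKpos : 0 < K := by positivity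
  have hinit : ∀ t ∈ Icc τ (2 * τ), W t < K := fun t ht =>
    lt_of_le_of_lt ((hK₀ (mem_image_of_mem W ht)).trans (le_max_left _ _)) (lt_add_one _)
  have hbound : ∀ t, 2 * τ ≤ t → W t < K := by
    by_contra! hcon
    set A : Set ℝ := {t | t ∈ Ici (2 * τ) ∧ W t ∈ Ici K} with hA
    have hAc : IsClosed A :=
      ContinuousOn.preimage_isClosed_of_isClosed
        (hWc.mono fun t ht => lt_of_lt_of_le (by linarith : 0 < 2 * τ) ht) isClosed_Ici isClosed_Ici
    have hAb : BddBelow A := ⟨2 * τ, fun t ht => ht.1⟩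
    have hAn : A.Nonempty := by
      obtain ⟨t, h1, h2⟩ := hcon
      exact ⟨t, h1, h2⟩
    set t₁ := sInf A with ht₁
    obtain ⟨hm1, hm2⟩ : t₁ ∈ A := hAc.csInf_mem hAn hAb
    simp only [mem_Ici] at hm1 hm2
    have hlt : ∀ s, τ ≤ s → s < t₁ → W s < K := by
      intro s hs hst
      rcases le_total s (2 * τ) with h | h
      · exact hinit s ⟨hs, h⟩
      · by_contra! hc
        exact absurd (csInf_le hAb (show s ∈ A from ⟨h, hc⟩)) (not_le.2 hst)
    have hpos : 0 < t₁ := by linarith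
    have hVpos : 0 < V t₁ := by
      have : 0 < Real.exp (γ * t₁) * V t₁ := lt_of_lt_of_le hKpos hm2
      exact pos_of_mul_pos_right this (Real.exp_pos _).le
    have hwin : ∀ s ∈ Icc (t₁ - τ) t₁, V s ≤ q * V t₁ := by
      intro s hs
      have hWs : W s ≤ W t₁ := by
        rcases hs.2.eq_or_lt with h | h
        · rw [h]
        · exact (hlt s (by linarith [hs.1]) h).le.trans hm2
      have h1 : Real.exp (γ * t₁) ≤ Real.exp (γ * s) * q := by
        refine le_trans ?_ (mul_le_mul_of_nonneg_left hγq (Real.exp_pos _).le)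
        rw [← Real.exp_add]
        refine Real.exp_le_exp.2 ?_
        nlinarith [hs.1]
      have h2 : Real.exp (γ * s) * V s ≤ Real.exp (γ * s) * (q * V t₁) := by
        calc _ ≤ Real.exp (γ * t₁) * V t₁ := hWs
          _ ≤ (Real.exp (γ * s) * q) * V t₁ := mul_le_mul_of_nonneg_right h1 hVpos.le
          _ = _ := by ring
      exact le_of_mul_le_mul_left h2 (Real.exp_pos _)
    have hdec := hdecay t₁ (by linarith) hwin
    have hnn := deriv_nonneg_of_le_left (show τ < t₁ by linarith) (hW t₁ hpos)
      (fun s h1 h2 => (hlt s h1 h2).le.trans hm2)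
    have hneg : γ * V t₁ + V' t₁ < 0 := by nlinarith
    exact absurd hnn (not_le.2 (mul_neg_of_pos_of_neg (Real.exp_pos _) hneg))
  have hexp : Tendsto (fun t => K * Real.exp (-(γ * t))) atTop (𝓝 0) := by
    have h1 : Tendsto (fun t : ℝ => γ * t) atTop atTop := tendsto_id.const_mul_atTop hγ0
    simpa using (Real.tendsto_exp_neg_atTop_nhds_zero.comp h1).const_mul K
  refine squeeze_zero' (Eventually.of_forall hV0) ?_ hexp
  filter_upwards [eventually_ge_atTop (2 * τ)] with t ht
  rw [Real.exp_neg, ← div_eq_mul_inv, le_div_iff₀ (Real.exp_pos _), mul_comm]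
  exact (hbound t ht).le

/-! ### Stability of a linear system with a small delay -/

section Delay

variable {ι : Type*} [Fintype ι]

theorem hasDerivAt_mulVec {f : ℝ → ι → ℝ} {f' : ι → ℝ} {t : ℝ} (M : Matrix ι ι ℝ)
    (hf : HasDerivAt f f' t) : HasDerivAt (fun s => M *ᵥ f s) (M *ᵥ f') t :=
  (Matrix.mulVecLin M).toContinuousLinearMap.hasFDerivAt.comp_hasDerivAt t hf

theorem hasDerivAt_dotProduct {f g : ℝ → ι → ℝ} {f' g' : ι → ℝ} {t : ℝ}
    (hf : HasDerivAt f f' t) (hg : HasDerivAt g g' t) :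
    HasDerivAt (fun s => f s ⬝ᵥ g s) (f' ⬝ᵥ g t + f t ⬝ᵥ g') t := by
  rw [hasDerivAt_pi] at hf hg
  have := HasDerivAt.fun_sum (u := Finset.univ) fun i _ => (hf i).mul (hg i)
  simpa [dotProduct, Finset.sum_add_distrib] using this

variable [DecidableEq ι]

/-- Young's inequality for the scalar product, weighted by a positive definite matrix. -/
theorem two_mul_dotProduct_le {P : Matrix ι ι ℝ} (hP : P.PosDef) (u y : ι → ℝ) :
    2 * (u ⬝ᵥ y) ≤ u ⬝ᵥ P⁻¹ *ᵥ u + y ⬝ᵥ P *ᵥ y := by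
  have hinv : P *ᵥ (P⁻¹ *ᵥ u) = u := by
    rw [Matrix.mulVec_mulVec,
      Matrix.mul_nonsing_inv _ ((Matrix.isUnit_iff_isUnit_det P).1 hP.isUnit), Matrix.one_mulVec]
  have h := hP.posSemidef.dotProduct_mulVec_nonneg (P⁻¹ *ᵥ u - y)
  simp only [star_trivial, Matrix.mulVec_sub, hinv, sub_dotProduct, dotProduct_sub] at h
  rw [dotProduct_mulVec_comm_of_isHermitian hP.isHermitian (P⁻¹ *ᵥ u) y, hinv,
    dotProduct_comm (P⁻¹ *ᵥ u), dotProduct_comm y u] at h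
  linarith

theorem abs_two_mul_dotProduct_le {P : Matrix ι ι ℝ} (hP : P.PosDef) (u y : ι → ℝ) :
    |2 * (u ⬝ᵥ y)| ≤ u ⬝ᵥ P⁻¹ *ᵥ u + y ⬝ᵥ P *ᵥ y := by
  rw [abs_le']
  refine ⟨two_mul_dotProduct_le hP u y, ?_⟩
  have := two_mul_dotProduct_le hP u (-y)
  simp only [dotProduct_neg, Matrix.mulVec_neg, neg_dotProduct, neg_neg] at this
  linarith

variable {C E P Q : Matrix ι ι ℝ} {ε : ℝ → ι → ℝ} {r : ℝ → ℝ} {τ : ℝ}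

/-- Effect of the delay: since `E * E = 0`, the derivative of `E ε` is `E C ε`, without any delayed
term, and the mean value inequality bounds the contribution of `ε (t - r t) - ε t` by the length
of the delay. -/
theorem delay_term_le (hP : P.PosDef) (hEE : E * E = 0)
    (hε : ∀ t, 0 < t → HasDerivAt ε (C *ᵥ ε t + E *ᵥ ε (t - r t)) t)
    {q t : ℝ} (hr0 : 0 ≤ r t) (hrt : r t < t)
    (hwin : ∀ s ∈ Icc (t - r t) t, ε s ⬝ᵥ P *ᵥ ε s ≤ q * (ε t ⬝ᵥ P *ᵥ ε t)) :
    2 * (ε t ⬝ᵥ (P * E) *ᵥ (ε (t - r t) - ε t)) ≤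
      r t * (ε t ⬝ᵥ (P * E * C * P⁻¹ * Cᵀ * Eᵀ * P) *ᵥ ε t + q * (ε t ⬝ᵥ P *ᵥ ε t)) := by
  set x := ε t with hx
  have hPT : Pᵀ = P := by simpa [Matrix.IsHermitian] using hP.isHermitian
  set u : ι → ℝ := (P * E * C)ᵀ *ᵥ x with hu
  have hderiv : ∀ s, 0 < s →
      HasDerivAt (fun s => 2 * (x ⬝ᵥ (P * E) *ᵥ ε s)) (2 * (u ⬝ᵥ ε s)) s := by
    intro s hs
    have h1 := (hasDerivAt_dotProduct (hasDerivAt_const s x)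
      (hasDerivAt_mulVec (P * E) (hε s hs))).const_mul 2
    refine h1.congr_deriv ?_
    rw [zero_dotProduct, zero_add, Matrix.mulVec_add, Matrix.mulVec_mulVec, Matrix.mulVec_mulVec,
      Matrix.mul_assoc P E E, hEE, Matrix.mul_zero, Matrix.zero_mulVec, add_zero, hu,
      Matrix.mulVec_transpose, ← Matrix.dotProduct_mulVec]
  have huu : u ⬝ᵥ P⁻¹ *ᵥ u = x ⬝ᵥ (P * E * C * P⁻¹ * Cᵀ * Eᵀ * P) *ᵥ x := by
    have : P * E * C * P⁻¹ * Cᵀ * Eᵀ * P = P * E * C * (P⁻¹ * (P * E * C)ᵀ) := by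
      simp only [Matrix.transpose_mul, hPT, Matrix.mul_assoc]
    rw [this, ← Matrix.mulVec_mulVec _ (P * E * C), ← Matrix.mulVec_mulVec _ P⁻¹, ← hu,
      Matrix.dotProduct_mulVec x,
      ← Matrix.mulVec_transpose, ← hu]
  have hle : t - r t ≤ t := by linarith
  have hmv := norm_image_sub_le_of_norm_deriv_le_segment' (a := t - r t) (b := t)
    (fun s hs => (hderiv s (by linarith [hs.1])).hasDerivWithinAt)
    (C := x ⬝ᵥ (P * E * C * P⁻¹ * Cᵀ * Eᵀ * P) *ᵥ x + q * (x ⬝ᵥ P *ᵥ x))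
    (fun s hs => by
      rw [Real.norm_eq_abs, ← huu]
      exact (abs_two_mul_dotProduct_le hP u (ε s)).trans
        (by gcongr; exact hwin s ⟨hs.1, hs.2.le⟩))
    t ⟨hle, le_rfl⟩
  rw [Real.norm_eq_abs, abs_le] at hmv
  rw [Matrix.mulVec_sub, dotProduct_sub]
  have := hmv.1
  simp only [sub_sub_cancel] at this
  linarith

/-- The Lyapunov–Razumikhin criterion for `ε' = C ε + E ε(t - r)` with `E * E = 0`, where `P` is a
Lyapunov matrix of the undelayed system `ε' = (C + E) ε`. As only the bound `r t < τ` is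
available, a uniform decay rate comes from applying Razumikhin's principle with a factor strictly
between `1` and `q`. -/
theorem tendsto_zero_of_small_delay [Nonempty ι] (hP : P.PosDef) (hQ : Q.PosDef)
    (hEE : E * E = 0) (hPQ : P * (C + E) + (C + E)ᵀ * P = -Q) (hτ : 0 < τ) {q : ℝ} (hq : 1 < q)
    (hτq : τ * (matNorm (P * E * C * P⁻¹ * Cᵀ * Eᵀ * P) + q * matNorm P) ≤ minEigenvalue Q)
    (hr : ∀ t, 0 ≤ t → 0 < r t ∧ r t < τ)
    (hε : ∀ t, 0 < t → HasDerivAt ε (C *ᵥ ε t + E *ᵥ ε (t - r t)) t) :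
    Tendsto ε atTop (𝓝 0) := by
  set M := P * E * C * P⁻¹ * Cᵀ * Eᵀ * P with hM
  have hPpos := matNorm_pos hP
  have hPT : Pᵀ = P := by simpa [Matrix.IsHermitian] using hP.isHermitian
  -- `q₁ < q` frees the share `η` of the decay, uniformly in `t`
  set q₁ := (1 + q) / 2 with hq₁
  set η := τ * ((q - q₁) * matNorm P) with hη
  have hqq : 0 < q - q₁ := by rw [hq₁]; linarith
  have hη0 : 0 < η := mul_pos hτ (mul_pos hqq hPpos)
  have hητ : τ * (matNorm M + q₁ * matNorm P) + η ≤ minEigenvalue Q := by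
    refine le_trans (le_of_eq ?_) hτq
    rw [hη]; ring
  set V : ℝ → ℝ := fun t => ε t ⬝ᵥ P *ᵥ ε t with hVdef
  set V' : ℝ → ℝ := fun t => 2 * (ε t ⬝ᵥ P *ᵥ (C *ᵥ ε t + E *ᵥ ε (t - r t))) with hV'def
  have hV0 : ∀ t, 0 ≤ V t := fun t => by
    simpa using hP.posSemidef.dotProduct_mulVec_nonneg (ε t)
  have hV : ∀ t, 0 < t → HasDerivAt V (V' t) t := by
    intro t ht
    have h1 := hasDerivAt_dotProduct (hε t ht) (hasDerivAt_mulVec P (hε t ht))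
    refine h1.congr_deriv ?_
    rw [dotProduct_mulVec_comm_of_isHermitian hP.isHermitian (C *ᵥ ε t + E *ᵥ ε (t - r t)) (ε t)]
    simp only [hV'def]; ring
  have hsplit : ∀ t, V' t = -(ε t ⬝ᵥ Q *ᵥ ε t) +
      2 * (ε t ⬝ᵥ (P * E) *ᵥ (ε (t - r t) - ε t)) := by
    intro t
    have h1 : ε t ⬝ᵥ (-Q) *ᵥ ε t = 2 * (ε t ⬝ᵥ (P * (C + E)) *ᵥ ε t) := by
      rw [← hPQ, Matrix.add_mulVec, dotProduct_add]
      have h2 : ε t ⬝ᵥ ((C + E)ᵀ * P) *ᵥ ε t = ε t ⬝ᵥ (P * (C + E)) *ᵥ ε t := by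
        have h3 : (C + E)ᵀ * P = (P * (C + E))ᵀ := by rw [Matrix.transpose_mul, hPT]
        rw [h3, Matrix.mulVec_transpose, dotProduct_comm, ← Matrix.dotProduct_mulVec]
      rw [h2]; ring
    rw [Matrix.neg_mulVec, dotProduct_neg] at h1
    rw [h1]
    simp only [hV'def, Matrix.mulVec_add, Matrix.mulVec_sub, Matrix.mulVec_mulVec, Matrix.mul_add,
      Matrix.add_mulVec, dotProduct_add, dotProduct_sub]
    ring
  have hlim : Tendsto V atTop (𝓝 0) := by
    refine razumikhin (δ := η / matNorm P) hτ (show 1 < q₁ by rw [hq₁]; linarith)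
      (div_pos hη0 hPpos) hV0 hV fun t ht hwin => ?_
    obtain ⟨hr0, hrτ⟩ := hr t (by linarith)
    have h1 := delay_term_le hP hEE hε hr0.le (hrτ.trans ht)
      (fun s hs => hwin s ⟨by linarith [hs.1], hs.2⟩)
    have h2 := minEigenvalue_mul_le hQ.isHermitian (ε t)
    have h3 := quadratic_le_matNorm M (ε t)
    have h4 : V t ≤ matNorm P * (ε t ⬝ᵥ ε t) := quadratic_le_matNorm P (ε t)
    have hx := dotProduct_self_nonneg (ε t)
    have hMn := matNorm_nonneg M
    have h5 : r t * (ε t ⬝ᵥ M *ᵥ ε t + q₁ * (ε t ⬝ᵥ P *ᵥ ε t)) ≤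
        τ * (matNorm M + q₁ * matNorm P) * (ε t ⬝ᵥ ε t) := by
      calc _ ≤ r t * (matNorm M * (ε t ⬝ᵥ ε t) + q₁ * (matNorm P * (ε t ⬝ᵥ ε t))) := by
            gcongr
        _ ≤ τ * (matNorm M * (ε t ⬝ᵥ ε t) + q₁ * (matNorm P * (ε t ⬝ᵥ ε t))) := by
            gcongr
        _ = _ := by ring
    have h6 : η / matNorm P * V t ≤ η * (ε t ⬝ᵥ ε t) := by
      rw [div_mul_eq_mul_div, div_le_iff₀ hPpos]
      nlinarith
    have h7 := mul_le_mul_of_nonneg_right hητ hx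
    rw [hsplit t]
    linarith
  have hc := minEigenvalue_pos hP
  rw [tendsto_pi_nhds]
  intro i
  have hsq : Tendsto (fun t => ε t i ^ 2) atTop (𝓝 0) := by
    refine squeeze_zero (fun t => sq_nonneg _) (fun t => ?_)
      (by simpa using hlim.div_const (minEigenvalue P))
    rw [le_div_iff₀ hc, mul_comm]
    refine le_trans ?_ (minEigenvalue_mul_le hP.isHermitian (ε t))
    gcongr
    rw [sq]
    exact Finset.single_le_sum (f := fun j => ε t j * ε t j) (fun j _ => mul_self_nonneg _)
      (Finset.mem_univ i)
  rw [Pi.zero_apply, tendsto_zero_iff_abs_tendsto_zero]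
  simpa [Function.comp_def, Real.sqrt_sq_eq_abs] using (Real.continuous_sqrt.tendsto 0).comp hsq

end Delay

/-! ### Paths -/

section Paths

variable {V : Type*} {G : Digraph V} {u v w : V}

theorem hasPath_of_adj (huw : u ≠ w) (h : G.Adj u w) : HasPath G u w := by
  refine ⟨1, le_rfl, ![u, w], ?_, rfl, rfl, ?_⟩
  · intro i j hij
    fin_cases i <;> fin_cases j <;> simp_all [eq_comm]
  · intro s
    fin_cases s
    exact h

/-- Prepending an arc to a path. If the new node already lies on the path, the part of the path
from that node on is taken instead, as the nodes of a path are distinct. -/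
theorem HasPath.cons (huw : u ≠ w) (h : G.Adj u v) (hp : HasPath G v w) : HasPath G u w := by
  obtain ⟨f, hf, p, hinj, h0, hlast, hadj⟩ := hp
  by_cases hu : u ∈ Set.range p
  · obtain ⟨s, hs⟩ := hu
    have hsf : s.1 < f := by
      rcases Nat.lt_succ_iff_lt_or_eq.1 s.2 with h | h
      · exact h
      · exact absurd (by rw [← hs, ← hlast]; congr 1; ext; exact h) huw
    refine ⟨f - s.1, by omega, fun t => p ⟨s.1 + t.1, by omega⟩, ?_, ?_, ?_, ?_⟩
    · intro a b hab
      have := hinj hab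
      simp only [Fin.mk.injEq] at this
      ext
      omega
    · exact hs
    · refine (congrArg p (Fin.ext ?_)).trans hlast
      simp only [Fin.val_last]
      omega
    · intro t
      exact hadj ⟨s.1 + t.1, by omega⟩
  · refine ⟨f + 1, by omega, Fin.cons u p, Fin.cons_injective_iff.2 ⟨hu, hinj⟩, rfl, ?_, ?_⟩
    · rw [← Fin.succ_last, Fin.cons_succ, hlast]
    · intro s
      refine Fin.cases ?_ (fun s => ?_) s
      · rw [Fin.castSucc_zero, Fin.cons_zero, Fin.cons_succ, h0]
        exact h
      · rw [← Fin.succ_castSucc, Fin.cons_succ, Fin.cons_succ]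
        exact hadj s

theorem HasPath.of_closed {p : V → Prop} (hp : ∀ a b, G.Adj a b → p a → p b)
    (h : HasPath G u w) (hu : p u) : p w := by
  obtain ⟨f, -, q, -, rfl, rfl, hadj⟩ := h
  have : ∀ s, p (q s) := fun s =>
    Fin.induction (motive := fun s => p (q s)) hu (fun s hs => hp _ _ (hadj s) hs) s
  exact this _

end Paths

/-! ### The matrix of the network -/

section Network

variable {n : ℕ} {N : Network n}

theorem H_mulVec (N : Network n) (x : Fin n → ℝ) (i : Fin n) :
    (N.H *ᵥ x) i = ∑ j, N.A i j * (x i - x j) + N.b i * x i := by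
  have : (N.A *ᵥ x) i = ∑ j, N.A i j * x j := rfl
  simp only [Network.H, Network.laplacian, Matrix.add_mulVec, Matrix.sub_mulVec, Pi.add_apply,
    Pi.sub_apply, Matrix.mulVec_diagonal, mul_sub, Finset.sum_sub_distrib, Finset.sum_mul, this]

theorem H_apply_of_ne (N : Network n) {i j : Fin n} (hij : i ≠ j) : N.H i j = -N.A i j := by
  simp [Network.H, Network.laplacian, hij]

theorem sum_H_apply (N : Network n) (i : Fin n) : ∑ j, N.H i j = N.b i := by
  have h : (N.H *ᵥ fun _ => (1 : ℝ)) i = ∑ j, N.H i j := by simp [Matrix.mulVec, dotProduct]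
  rw [← h, H_mulVec]
  simp

/-- If some follower has no path to the leader then `H` is singular: the rows of `H` belonging to
the followers without a path are supported on these followers and have vanishing sums. -/
theorem exists_H_mulVec_eq_zero (h : ¬ N.LeaderGloballyReachable) :
    ∃ x ≠ 0, N.H *ᵥ x = 0 := by
  classical
  set p : Fin n → Prop := fun i => HasPath N.augmentedGraph (some i) none with hp
  obtain ⟨i₀, hi₀⟩ : ∃ i, ¬ p i := not_forall.1 h
  have hb : ∀ i, ¬ p i → N.b i = 0 := fun i hi =>
    le_antisymm (not_lt.1 fun hlt => hi (hasPath_of_adj (by simp) hlt)) (N.b_nonneg i)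
  have hA : ∀ i, ¬ p i → ∀ j, p j → N.H i j = 0 := by
    intro i hi j hj
    rw [H_apply_of_ne N (by rintro rfl; exact hi hj), neg_eq_zero]
    exact le_antisymm (not_lt.1 fun hlt => hi (HasPath.cons (v := some j) (by simp) hlt hj))
      (N.A_nonneg i j)
  rw [Matrix.exists_mulVec_eq_zero_iff, Matrix.twoBlockTriangular_det N.H p hA]
  refine mul_eq_zero_of_right _ (Matrix.exists_mulVec_eq_zero_iff.1
    ⟨fun _ => 1, fun h0 => one_ne_zero (congrFun h0 ⟨i₀, hi₀⟩), ?_⟩)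
  ext ⟨i, hi⟩
  have hsum : ∑ j : {j // ¬ p j}, N.H i j = ∑ j, N.H i j := by
    have h0 : ∑ j : {j // p j}, N.H i j = 0 := Finset.sum_eq_zero fun j _ => hA i hi j j.2
    rw [← Fintype.sum_subtype_add_sum_subtype p (fun j => N.H i j), h0, zero_add]
  have h1 : ((N.H.toSquareBlockProp fun i => ¬ p i) *ᵥ fun _ => (1 : ℝ)) ⟨i, hi⟩
      = ∑ j : {j // ¬ p j}, N.H i j := by
    simp [Matrix.mulVec, dotProduct, Matrix.toSquareBlockProp_def]
  rw [h1, hsum, sum_H_apply, hb i hi, Pi.zero_apply]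

/-- The minimum principle: if the leader is globally reachable and `H x ≥ 0` then `x ≥ 0`. A
negative minimum would be attained at all successors of a minimiser, hence along a path to the
leader, whose weight at the last follower then gives a contradiction. -/
theorem nonneg_of_H_mulVec_nonneg (h : N.LeaderGloballyReachable) {x : Fin n → ℝ}
    (hx : ∀ i, 0 ≤ (N.H *ᵥ x) i) (i : Fin n) : 0 ≤ x i := by
  have : Nonempty (Fin n) := ⟨i⟩
  obtain ⟨i₀, hmin⟩ := Finite.exists_min x
  by_contra! hi
  have hneg : x i₀ < 0 := (hmin i).trans_lt hi
  have hstep : ∀ j, x j = x i₀ → N.b j = 0 ∧ ∀ l, 0 < N.A j l → x l = x i₀ := by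
    intro j hj
    have h1 := hx j
    rw [H_mulVec] at h1
    have h2 : ∀ l ∈ Finset.univ, N.A j l * (x j - x l) ≤ 0 := fun l _ =>
      mul_nonpos_of_nonneg_of_nonpos (N.A_nonneg j l) (by linarith [hmin l])
    have h3 := Finset.sum_nonpos h2
    have h4 : N.b j * x j ≤ 0 :=
      mul_nonpos_of_nonneg_of_nonpos (N.b_nonneg j) (by linarith)
    have h5 : N.b j * x j = 0 := by linarith
    refine ⟨(mul_eq_zero.1 h5).resolve_right (by rw [hj]; exact hneg.ne), fun l hl => ?_⟩
    have h6 : ∑ l, N.A j l * (x j - x l) = 0 := by linarith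
    have h7 := (Finset.sum_eq_zero_iff_of_nonpos h2).1 h6 l (Finset.mem_univ l)
    linarith [(mul_eq_zero.1 h7).resolve_left hl.ne']
  let p : Option (Fin n) → Prop := fun o => o.elim False fun j => x j = x i₀
  refine HasPath.of_closed (p := p) ?_ (h i₀) rfl
  rintro (_ | j) (_ | l) hadj hj
  · exact hj
  · exact hj.elim
  · exact absurd (hstep j hj).1 (ne_of_gt hadj)
  · exact (hstep j hj).2 l hadj

theorem isUnit_det_H (h : N.LeaderGloballyReachable) : IsUnit N.H.det := by
  rw [isUnit_iff_ne_zero]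
  intro hdet
  obtain ⟨x, hx0, hx⟩ := Matrix.exists_mulVec_eq_zero_iff.2 hdet
  refine hx0 (funext fun i => le_antisymm ?_ ?_)
  · have := nonneg_of_H_mulVec_nonneg h (x := -x) (by simp [Matrix.mulVec_neg, hx]) i
    simpa using this
  · exact nonneg_of_H_mulVec_nonneg h (by simp [hx]) i

theorem exists_pos_vecMul_H_eq_one (h : N.LeaderGloballyReachable) :
    ∃ v : Fin n → ℝ, (∀ i, 0 < v i) ∧ v ᵥ* N.H = 1 := by
  have hu := isUnit_det_H h
  refine ⟨1 ᵥ* N.H⁻¹, fun j => ?_, ?_⟩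
  · set y : Fin n → ℝ := N.H⁻¹ *ᵥ Pi.single j 1 with hy
    have hHy : N.H *ᵥ y = Pi.single j 1 := by
      rw [hy, Matrix.mulVec_mulVec, Matrix.mul_nonsing_inv _ hu, Matrix.one_mulVec]
    have hy0 : ∀ i, 0 ≤ y i := nonneg_of_H_mulVec_nonneg h fun i => by
      rw [hHy]
      exact (Pi.single_nonneg (α := fun _ : Fin n => ℝ)).2 zero_le_one i
    have hsum : (1 ᵥ* N.H⁻¹) j = ∑ i, y i := by
      simp [hy, Matrix.vecMul, dotProduct]
    rw [hsum]
    obtain ⟨i, hi⟩ : ∃ i, y i ≠ 0 := by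
      by_contra! hc
      have : y = 0 := funext hc
      rw [this, Matrix.mulVec_zero] at hHy
      simpa using congrFun hHy j
    exact Finset.sum_pos' (fun i _ => hy0 i) ⟨i, Finset.mem_univ i, lt_of_le_of_ne (hy0 i) hi.symm⟩
  · rw [Matrix.vecMul_vecMul, Matrix.nonsing_inv_mul _ hu, Matrix.vecMul_one]

/-- If `v` is positive with `vᵀ H` the all-ones vector, then the diagonal matrix of `v` is a strict
Lyapunov matrix for `H`: from `2 x i (x i - x j) = (x i - x j)² + x i² - x j²`, twice
`∑ v i x i (H x) i` is at least `∑ v i (H x²) i = ∑ x i²`. -/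
theorem posDef_diagonal_mul_H {v : Fin n → ℝ} (hv : ∀ i, 0 < v i) (hvH : v ᵥ* N.H = 1) :
    (Matrix.diagonal v * N.H + N.Hᵀ * Matrix.diagonal v).PosDef := by
  refine Matrix.PosDef.of_dotProduct_mulVec_pos ?_ fun x hx => ?_
  · simp [Matrix.IsHermitian, Matrix.conjTranspose_eq_transpose_of_trivial, add_comm]
  · have hq : star x ⬝ᵥ (Matrix.diagonal v * N.H + N.Hᵀ * Matrix.diagonal v) *ᵥ x =
        ∑ i, 2 * (v i * x i * (N.H *ᵥ x) i) := by
      rw [star_trivial, Matrix.add_mulVec, dotProduct_add, ← Matrix.mulVec_mulVec,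
        ← Matrix.mulVec_mulVec, Matrix.dotProduct_mulVec x N.Hᵀ, Matrix.vecMul_transpose,
        dotProduct, dotProduct, ← Finset.sum_add_distrib]
      refine Finset.sum_congr rfl fun i _ => ?_
      rw [Matrix.mulVec_diagonal, Matrix.mulVec_diagonal]
      ring
    have hsq : ∑ i, v i * (N.H *ᵥ fun j => x j ^ 2) i = ∑ i, x i ^ 2 := by
      have h1 : v ⬝ᵥ (N.H *ᵥ fun j => x j ^ 2) = 1 ⬝ᵥ fun j => x j ^ 2 := by
        rw [Matrix.dotProduct_mulVec, hvH]
      simpa [dotProduct] using h1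
    have hle : ∀ i, v i * (N.H *ᵥ fun j => x j ^ 2) i ≤ 2 * (v i * x i * (N.H *ᵥ x) i) := by
      intro i
      have h1 : (N.H *ᵥ fun j => x j ^ 2) i ≤ 2 * (x i * (N.H *ᵥ x) i) := by
        rw [H_mulVec, H_mulVec, mul_add, mul_add, Finset.mul_sum, Finset.mul_sum]
        refine add_le_add (Finset.sum_le_sum fun j _ => ?_) ?_
        · nlinarith [mul_nonneg (N.A_nonneg i j) (sq_nonneg (x i - x j))]
        · nlinarith [mul_nonneg (N.b_nonneg i) (sq_nonneg (x i))]
      calc _ ≤ v i * (2 * (x i * (N.H *ᵥ x) i)) := mul_le_mul_of_nonneg_left h1 (hv i).le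
        _ = _ := by ring
    rw [hq]
    refine lt_of_lt_of_le ?_ (hsq ▸ Finset.sum_le_sum fun i _ => hle i)
    obtain ⟨i, hi⟩ := Function.ne_iff.1 hx
    exact Finset.sum_pos' (fun i _ => sq_nonneg _) ⟨i, Finset.mem_univ i, by
      have : x i ≠ 0 := hi
      positivity⟩

theorem existsUnique_lyapunovSolution_of_reachable (h : N.LeaderGloballyReachable) :
    ∃! P : Matrix (Fin n) (Fin n) ℝ, IsLyapunovSolution N.H P := by
  obtain ⟨v, hv, hvH⟩ := exists_pos_vecMul_H_eq_one h
  exact existsUnique_lyapunovSolution hv (posDef_diagonal_mul_H hv hvH)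

/-- A kernel vector of `H`, as position error with zero velocity error, is an equilibrium. -/
theorem reachable_of_errorsVanish {k τ : ℝ} {r : ℝ → ℝ} (h : ErrorsVanish N k τ r) :
    N.LeaderGloballyReachable := by
  by_contra hN
  obtain ⟨x, hx0, hx⟩ := exists_H_mulVec_eq_zero hN
  have hlim := h (fun _ => Sum.elim x 0) ⟨continuousOn_const, fun t _ => by
    refine (hasDerivAt_const t (Sum.elim x 0 : Fin n ⊕ Fin n → ℝ)).congr_deriv ?_
    simp [matC, matE, Matrix.fromBlocks_mulVec, Matrix.neg_mulVec, hx]⟩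
  have h0 := tendsto_nhds_unique tendsto_const_nhds hlim
  exact hx0 (funext fun i => congrFun h0 (Sum.inl i))

end Network

/-! ### The Lyapunov matrix of the second-order system -/

section Gain

variable {n : ℕ} {H P : Matrix (Fin n) (Fin n) ℝ} {k : ℝ}

theorem IsLyapunovSolution.transpose_eq (hP : IsLyapunovSolution H P) : Pᵀ = P := by
  simpa [Matrix.IsHermitian] using hP.1.isHermitian

theorem dotProduct_mulVec_mul_transpose (M : Matrix (Fin n) (Fin n) ℝ) (y : Fin n → ℝ) :
    y ⬝ᵥ (M * Mᵀ) *ᵥ y = (Mᵀ *ᵥ y) ⬝ᵥ (Mᵀ *ᵥ y) := by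
  rw [← Matrix.mulVec_mulVec, Matrix.dotProduct_mulVec, ← Matrix.mulVec_transpose]

theorem isHermitian_mul_transpose_mul (hP : IsLyapunovSolution H P) :
    P * H * Hᵀ * P = (P * H) * (P * H)ᵀ ∧ (P * H * Hᵀ * P).IsHermitian := by
  have h : P * H * Hᵀ * P = (P * H) * (P * H)ᵀ := by
    rw [Matrix.transpose_mul, hP.transpose_eq, Matrix.mul_assoc _ Hᵀ]
  refine ⟨h, ?_⟩
  rw [h]
  exact Matrix.isHermitian_mul_conjTranspose_self (P * H)

/-- The largest eigenvalue of `P H Hᵀ P` dominates the squared norm of `Hᵀ P`. -/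
theorem norm_sq_le_maxEigenvalue (hP : IsLyapunovSolution H P) (y : Fin n → ℝ) :
    (Hᵀ * P) *ᵥ y ⬝ᵥ (Hᵀ * P) *ᵥ y ≤ maxEigenvalue (P * H * Hᵀ * P) * (y ⬝ᵥ y) := by
  obtain ⟨h1, h2⟩ := isHermitian_mul_transpose_mul hP
  have h3 := le_maxEigenvalue_mul h2 y
  have h4 : y ⬝ᵥ (P * H * Hᵀ * P) *ᵥ y = (Hᵀ * P) *ᵥ y ⬝ᵥ (Hᵀ * P) *ᵥ y := by
    rw [h1, dotProduct_mulVec_mul_transpose, Matrix.transpose_mul, hP.transpose_eq]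
  rwa [h4] at h3

theorem maxEigenvalue_nonneg (hn : 1 ≤ n) (hP : IsLyapunovSolution H P) :
    0 ≤ maxEigenvalue (P * H * Hᵀ * P) := by
  set y : Fin n → ℝ := Pi.single ⟨0, hn⟩ 1 with hy
  have h1 := norm_sq_le_maxEigenvalue hP y
  have h2 : y ⬝ᵥ y = 1 := by simp [hy]
  rw [h2, mul_one] at h1
  exact (dotProduct_self_nonneg _).trans h1

theorem one_lt_of_kStar_lt (hn : 1 ≤ n) (hP : IsLyapunovSolution H P) (hk : kStar H P < k) :
    1 < k := by
  have : Nonempty (Fin n) := ⟨⟨0, hn⟩⟩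
  refine lt_of_le_of_lt ?_ hk
  rw [kStar, le_add_iff_nonneg_left]
  have := minEigenvalue_pos hP.1
  have := maxEigenvalue_nonneg hn hP
  positivity

theorem posDef_bigP (hP : P.PosDef) (hk : 1 < k) : (bigP k P).PosDef := by
  have hPT : Pᵀ = P := by simpa [Matrix.IsHermitian] using hP.isHermitian
  refine Matrix.PosDef.of_dotProduct_mulVec_pos ?_ fun z hz => ?_
  · exact Matrix.IsHermitian.fromBlocks (by simp [Matrix.IsHermitian, hPT]) hP.isHermitian
      hP.isHermitian
  · obtain ⟨x, y, rfl⟩ : ∃ x y, z = Sum.elim x y := ⟨_, _, (Sum.elim_comp_inl_inr z).symm⟩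
    have hq : star (Sum.elim x y) ⬝ᵥ bigP k P *ᵥ Sum.elim x y =
        (k - 1) * (x ⬝ᵥ P *ᵥ x) + (x + y) ⬝ᵥ P *ᵥ (x + y) := by
      rw [star_trivial, bigP, Matrix.fromBlocks_mulVec]
      simp only [Sum.elim_comp_inl, Sum.elim_comp_inr, sumElim_dotProduct_sumElim,
        Matrix.mulVec_add, dotProduct_add, add_dotProduct, Matrix.smul_mulVec, dotProduct_smul,
        smul_eq_mul]
      ring
    rw [hq]
    have h1 : 0 ≤ (x + y) ⬝ᵥ P *ᵥ (x + y) := by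
      simpa using hP.posSemidef.dotProduct_mulVec_nonneg (x + y)
    by_cases hx : x = 0
    · have hy : y ≠ 0 := by
        rintro rfl
        exact hz (by ext i; cases i <;> simp [hx])
      simpa [hx] using hP.dotProduct_mulVec_pos hy
    · have h2 : 0 < x ⬝ᵥ P *ᵥ x := by simpa using hP.dotProduct_mulVec_pos hx
      have := mul_pos (sub_pos.2 hk) h2
      linarith

/-- The gain threshold `k*` is what completing the square in the velocity component needs. -/
theorem posDef_bigQ (hn : 1 ≤ n) (hP : IsLyapunovSolution H P) (hk : kStar H P < k) :
    (bigQ k H P).PosDef := by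
  have : Nonempty (Fin n) := ⟨⟨0, hn⟩⟩
  have hPT := hP.transpose_eq
  have hl := minEigenvalue_pos hP.1
  have hk1 := one_lt_of_kStar_lt hn hP hk
  have hμ : maxEigenvalue (P * H * Hᵀ * P) < 2 * (k - 1) * minEigenvalue P := by
    have h1 : maxEigenvalue (P * H * Hᵀ * P) / (2 * minEigenvalue P) < k - 1 := by
      rw [kStar] at hk
      linarith
    rw [div_lt_iff₀ (by positivity)] at h1
    linarith
  refine Matrix.PosDef.of_dotProduct_mulVec_pos ?_ fun z hz => ?_
  · refine Matrix.IsHermitian.fromBlocks Matrix.isHermitian_one ?_ ?_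
    · rw [Matrix.conjTranspose_eq_transpose_of_trivial, Matrix.transpose_mul, hPT,
        Matrix.transpose_transpose]
    · simp [Matrix.IsHermitian, hPT]
  · obtain ⟨x, y, rfl⟩ : ∃ x y, z = Sum.elim x y := ⟨_, _, (Sum.elim_comp_inl_inr z).symm⟩
    set w := (Hᵀ * P) *ᵥ y with hw
    have hcross : y ⬝ᵥ (P * H) *ᵥ x = x ⬝ᵥ w := by
      have : P * H = (Hᵀ * P)ᵀ := by rw [Matrix.transpose_mul, hPT, Matrix.transpose_transpose]
      rw [this, Matrix.mulVec_transpose, dotProduct_comm, ← Matrix.dotProduct_mulVec]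
    have hq : star (Sum.elim x y) ⬝ᵥ bigQ k H P *ᵥ Sum.elim x y =
        (x + w) ⬝ᵥ (x + w) + (2 * (k - 1) * (y ⬝ᵥ P *ᵥ y) - w ⬝ᵥ w) := by
      rw [star_trivial, bigQ, Matrix.fromBlocks_mulVec]
      simp only [Sum.elim_comp_inl, Sum.elim_comp_inr, sumElim_dotProduct_sumElim,
        Matrix.one_mulVec, dotProduct_add, add_dotProduct, Matrix.smul_mulVec, dotProduct_smul,
        smul_eq_mul, hcross, ← hw, dotProduct_comm w x]
      ring
    rw [hq]
    have h1 := dotProduct_self_nonneg (x + w)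
    by_cases hy : y = 0
    · have hx : x ≠ 0 := by
        rintro rfl
        exact hz (by ext i; cases i <;> simp [hy])
      have hw0 : w = 0 := by simp [hw, hy]
      simpa [hw0, hy] using (Matrix.PosDef.one (n := Fin n) (R := ℝ)).dotProduct_mulVec_pos hx
    · have hyy : 0 < y ⬝ᵥ y := by
        simpa using (Matrix.PosDef.one (n := Fin n) (R := ℝ)).dotProduct_mulVec_pos hy
      have h2 := norm_sq_le_maxEigenvalue hP y
      have h3 := mul_le_mul_of_nonneg_left (minEigenvalue_mul_le hP.1.isHermitian y)
        (show 0 ≤ 2 * (k - 1) by linarith)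
      have h4 := mul_lt_mul_of_pos_right hμ hyy
      linarith

theorem matE_mul_self (H : Matrix (Fin n) (Fin n) ℝ) : matE H * matE H = 0 := by
  simp [matE, Matrix.fromBlocks_multiply]

theorem bigP_lyapunov (hP : IsLyapunovSolution H P) :
    bigP k P * (matC n k + matE H) + (matC n k + matE H)ᵀ * bigP k P = -bigQ k H P := by
  have h := hP.2
  simp only [bigP, matC, matE, bigQ, Matrix.fromBlocks_add, Matrix.fromBlocks_multiply,
    Matrix.fromBlocks_transpose, Matrix.fromBlocks_neg]
  congr 1
  · rw [← h]; simp [add_comm]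
  · simp
  · simp
  · simp only [mul_sub, sub_smul, two_mul, add_smul]
    simp
    abel

theorem delayBound_pos (hn : 1 ≤ n) (hP : IsLyapunovSolution H P) (hk : kStar H P < k) {q : ℝ}
    (hq : 1 < q) : 0 < delayBound k q H P := by
  have : Nonempty (Fin n) := ⟨⟨0, hn⟩⟩
  have h1 := minEigenvalue_pos (posDef_bigQ hn hP hk)
  have h2 := matNorm_pos (posDef_bigP hP.1 (one_lt_of_kStar_lt hn hP hk))
  exact div_pos h1 (add_pos_of_nonneg_of_pos (matNorm_nonneg _) (by positivity))

theorem errorsVanish_of_le_delayBound (hn : 1 ≤ n) {N : Network n}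
    (hP : IsLyapunovSolution N.H P) (hk : kStar N.H P < k) {q τ : ℝ} (hq : 1 < q) (hτ : 0 < τ)
    (hτq : τ ≤ delayBound k q N.H P) {r : ℝ → ℝ} (hr : IsDelay τ r) : ErrorsVanish N k τ r := by
  have : Nonempty (Fin n) := ⟨⟨0, hn⟩⟩
  have hPP := posDef_bigP hP.1 (one_lt_of_kStar_lt hn hP hk)
  have h2 := matNorm_pos hPP
  intro ε hε
  refine tendsto_zero_of_small_delay hPP (posDef_bigQ hn hP hk) (matE_mul_self N.H)
    (bigP_lyapunov hP) hτ hq ?_ hr.2 hε.2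
  rwa [delayBound, le_div_iff₀ (add_pos_of_nonneg_of_pos (matNorm_nonneg _) (by positivity))]
    at hτq

end Gain

end LeaderFollowing

theorem theorem1 {n : ℕ} (hn : 1 ≤ n) (N : LeaderFollowing.Network n) :
    -- if the leader is globally reachable, the matrix defining the gain threshold exists
    (N.LeaderGloballyReachable →
      ∃! P : Matrix (Fin n) (Fin n) ℝ, LeaderFollowing.IsLyapunovSolution N.H P) ∧
    -- the gain exceeds the threshold (whenever the threshold is defined)
    ∀ k : ℝ, 0 < k →
      (∀ P : Matrix (Fin n) (Fin n) ℝ, LeaderFollowing.IsLyapunovSolution N.H P →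
        LeaderFollowing.kStar N.H P < k) →
      -- for all sufficiently small bounds on the delay, convergence iff global reachability
      (∃ τ₀ : ℝ, 0 < τ₀ ∧ ∀ τ : ℝ, 0 < τ → τ ≤ τ₀ →
        ∀ r : ℝ → ℝ, LeaderFollowing.IsDelay τ r →
          (LeaderFollowing.ErrorsVanish N k τ r ↔ N.LeaderGloballyReachable)) ∧
      -- the explicit value of the bound on the delay
      (∀ P : Matrix (Fin n) (Fin n) ℝ, LeaderFollowing.IsLyapunovSolution N.H P →
        ∀ q : ℝ, 1 < q →
          0 < LeaderFollowing.delayBound k q N.H P ∧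
          ∀ τ : ℝ, 0 < τ → τ ≤ LeaderFollowing.delayBound k q N.H P →
            ∀ r : ℝ → ℝ, LeaderFollowing.IsDelay τ r →
              (LeaderFollowing.ErrorsVanish N k τ r ↔ N.LeaderGloballyReachable)) := by
  refine ⟨LeaderFollowing.existsUnique_lyapunovSolution_of_reachable, fun k _ hk => ?_⟩
  have explicit : ∀ P, LeaderFollowing.IsLyapunovSolution N.H P → ∀ q : ℝ, 1 < q →
      0 < LeaderFollowing.delayBound k q N.H P ∧
      ∀ τ : ℝ, 0 < τ → τ ≤ LeaderFollowing.delayBound k q N.H P →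
        ∀ r : ℝ → ℝ, LeaderFollowing.IsDelay τ r →
          (LeaderFollowing.ErrorsVanish N k τ r ↔ N.LeaderGloballyReachable) :=
    fun P hP q hq => ⟨LeaderFollowing.delayBound_pos hn hP (hk P hP) hq, fun τ hτ hτq r hr =>
      ⟨LeaderFollowing.reachable_of_errorsVanish, fun _ =>
        LeaderFollowing.errorsVanish_of_le_delayBound hn hP (hk P hP) hq hτ hτq hr⟩⟩
  refine ⟨?_, explicit⟩
  by_cases hN : N.LeaderGloballyReachable
  · obtain ⟨P, hP, -⟩ := LeaderFollowing.existsUnique_lyapunovSolution_of_reachable hN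
    exact ⟨_, explicit P hP 2 one_lt_two⟩
  · -- without reachability the errors do not vanish whatever the delay, so any bound will do
    exact ⟨1, one_pos, fun τ _ _ r _ =>
      ⟨LeaderFollowing.reachable_of_errorsVanish, fun h => absurd h hN⟩⟩
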